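/- Let $p$ be a prime, let $X=\{x_1,\dots,x_p\}$, and let $T$ be the $p$-adic rooted tree, whose vertices are the finite words over $X$; $L_n$ is the set of words of length $n$. For $g\in\operatorname{Aut}T$ and a vertex $u$, the section $g_u\in\operatorname{Aut}T$ is defined by $g(uv)=g(u)\,g_u(v)$. For $G\le\operatorname{Aut}T$ let $\mathrm{st}_G(L_n)$ be the subgroup of elements of $G$ fixing every vertex of $L_n$, and for $u\in L_n$ let $\psi_u(g)=g_u$ for $g\in\mathrm{st}_G(L_n)$. The group $G$ is self-similar if $g_u\in G$ for all $g\in G$ and all vertices $u$. A self-similar group $G$ is strongly fractal if $\psi_x(\mathrm{st}_G(L_1))=G$ for all $x\in X$, and super strongly fractal if $\psi_u(\mathrm{st}_G(L_n))=G$ for all $n\in\mathbb N$ and all $u\in L_n$. Let $a$ be the rooted automorphism corresponding to the cycle $(x_1\,x_2\,\dots\,x_p)$. For a non-zero vector $e=(e_1,\dots,e_{p-1})\in(\mathbb Z/p\mathbb Z)^{p-1}$ let $b_e$ be the automorphism fixing every vertex of $L_1$ whose sections at $x_1,\dots,x_p$ are $a^{e_1},\dots,a^{e_{p-1}},b_e$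 respectively. The GGS-group with defining vector $e$ is $G_e=\langle a,b_e\rangle$. **Proposition.** Let $e$ be a non-zero constant vector, $e=(c,\dots,c)$, and let $G=G_e$. Then $G$ is strongly fractal but not super strongly fractal. More precisely, put $b=b_{(1,\dots,1)}$. Then $b$ is a power of $b_e$ and $G=\langle a,b\rangle=G_{(1,\dots,1)}$; moreover, for the vertex $x_1x_1\in L_2$, $$\psi_{x_1x_1}(\mathrm{st}_G(L_2))=\langle b^{-1}a\rangle^G,$$ the normal closure of $b^{-1}a$ in $G$, and this is a proper subgroup of $G$. -/

import Mathlib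

/-- The regular rooted tree whose vertices are the finite words over the alphabet `X`: the root is
the empty word, and a word `u` is joined by an edge to each word `ux` with `x ∈ X`. -/
def wordTree (X : Type*) : SimpleGraph (List X) where
  Adj u v := (∃ x, v = u ++ [x]) ∨ (∃ x, u = v ++ [x])
  symm := ⟨fun _ _ h => h.symm⟩
  loopless := ⟨fun u h => by
    rcases h with ⟨x, h⟩ | ⟨x, h⟩ <;> simpa using congrArg List.length h⟩

/-- The group `Aut T` of automorphisms of the rooted tree: bijections of the set of vertices that
fix the root and preserve incidence. (The product of `f` and `g` is `f ∘ g`.) -/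
def AutTree (X : Type*) : Subgroup (Equiv.Perm (List X)) where
  carrier := {g | g [] = [] ∧ ∀ u v, (wordTree X).Adj (g u) (g v) ↔ (wordTree X).Adj u v}
  one_mem' := ⟨rfl, fun _ _ => Iff.rfl⟩
  mul_mem' := by
    rintro f g ⟨hf, hf'⟩ ⟨hg, hg'⟩
    exact ⟨by simp [hf, hg], fun u v => by simp [hf', hg']⟩
  inv_mem' := by
    rintro f ⟨hf, hf'⟩
    refine ⟨by rw [Equiv.Perm.inv_eq_iff_eq, hf], fun u v => ?_⟩
    rw [← hf' (f⁻¹ u) (f⁻¹ v)]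
    simp

theorem mem_autTree_of_child {X : Type*} (g : Equiv.Perm (List X)) (h0 : g [] = [])
    (h : ∀ u x, ∃ y, g (u ++ [x]) = g u ++ [y]) : g ∈ AutTree X := by
  have key : ∀ u v, (∃ y, g v = g u ++ [y]) ↔ ∃ x, v = u ++ [x] := by
    intro u v
    constructor
    · rintro ⟨y, hy⟩
      rcases List.eq_nil_or_concat v with rfl | ⟨w, x, rfl⟩
      · simp [h0] at hy
      · obtain ⟨z, hz⟩ := h w x
        rw [List.concat_eq_append, hz] at hy
        have := g.injective (List.append_inj_left' hy rfl)
        exact ⟨x, by rw [List.concat_eq_append, this]⟩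
    · rintro ⟨x, rfl⟩
      exact h u x
  exact ⟨h0, fun u v => or_congr (key u v) (key v u)⟩

namespace AutTree

theorem apply_nil {X : Type*} (g : AutTree X) : g.1 [] = [] := g.2.1

theorem apply_child {X : Type*} (g : AutTree X) (u : List X) (x : X) :
    ∃ y, g.1 (u ++ [x]) = g.1 u ++ [y] := by
  induction u using List.reverseRecOn generalizing x with
  | nil =>
    rcases (g.2.2 [] [x]).2 (Or.inl ⟨x, rfl⟩) with h | ⟨y, h⟩
    · exact h
    · simp [apply_nil] at h
  | append_singleton w z ih =>
    rcases (g.2.2 (w ++ [z]) (w ++ [z] ++ [x])).2 (Or.inl ⟨x, rfl⟩) with h | ⟨y, h⟩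
    · exact h
    · obtain ⟨t, ht⟩ := ih z
      rw [ht] at h
      have := g.1.injective (List.append_inj_left' h rfl)
      simpa using congrArg List.length this

theorem length_apply {X : Type*} (g : AutTree X) (u : List X) : (g.1 u).length = u.length := by
  induction u using List.reverseRecOn with
  | nil => simp [apply_nil]
  | append_singleton w z ih =>
    obtain ⟨t, ht⟩ := apply_child g w z
    simp [ht, ih]

theorem apply_append {X : Type*} (g : AutTree X) (u v : List X) :
    g.1 (u ++ v) = g.1 u ++ (g.1 (u ++ v)).drop u.length := by
  have : ∃ w, g.1 (u ++ v) = g.1 u ++ w := by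
    induction v using List.reverseRecOn with
    | nil => exact ⟨[], by simp⟩
    | append_singleton w z ih =>
      obtain ⟨t, ht⟩ := ih
      obtain ⟨y, hy⟩ := apply_child g (u ++ w) z
      exact ⟨t ++ [y], by rw [← List.append_assoc, hy, ht, List.append_assoc]⟩
  obtain ⟨w, hw⟩ := this
  rw [hw, ← length_apply g u, List.drop_left]

/-- The bijection underlying the section `g_u`. -/
def sectionEquiv {X : Type*} (g : AutTree X) (u : List X) : Equiv.Perm (List X) where
  toFun v := (g.1 (u ++ v)).drop u.length
  invFun v := (g⁻¹.1 (g.1 u ++ v)).drop u.length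
  left_inv v := by
    change (g⁻¹.1 (g.1 u ++ (g.1 (u ++ v)).drop u.length)).drop u.length = v
    rw [← apply_append]
    simp
  right_inv v := by
    change (g.1 (u ++ (g⁻¹.1 (g.1 u ++ v)).drop u.length)).drop u.length = v
    have h := apply_append g⁻¹ (g.1 u) v
    rw [length_apply] at h
    have h1 : g⁻¹.1 (g.1 u) = u := by simp
    rw [h1] at h
    rw [← h]
    have h2 : g.1 (g⁻¹.1 (g.1 u ++ v)) = g.1 u ++ v := by simp
    rw [h2, ← length_apply g u, List.drop_left]

/-- The section `g_u` of `g` at the vertex `u`, determined by `g (uv) = g (u) g_u (v)`. -/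
def sect {X : Type*} (g : AutTree X) (u : List X) : AutTree X :=
  ⟨sectionEquiv g u, mem_autTree_of_child _
    (by
      change (g.1 (u ++ [])).drop u.length = []
      simp [length_apply])
    (fun v x => by
      obtain ⟨y, hy⟩ := apply_child g (u ++ v) x
      refine ⟨y, ?_⟩
      change (g.1 (u ++ (v ++ [x]))).drop u.length = (g.1 (u ++ v)).drop u.length ++ [y]
      rw [← List.append_assoc, hy, List.drop_append_of_le_length]
      simp [length_apply])⟩

theorem apply_append_sect {X : Type*} (g : AutTree X) (u v : List X) :
    g.1 (u ++ v) = g.1 u ++ (sect g u).1 v := apply_append g u v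

/-- The stabilizer `st(u)` of the vertex `u`. -/
def vertexStab {X : Type*} (u : List X) : Subgroup (AutTree X) where
  carrier := {g | g.1 u = u}
  one_mem' := rfl
  mul_mem' := by
    intro f g (hf : f.1 u = u) (hg : g.1 u = u)
    change f.1 (g.1 u) = u
    rw [hg, hf]
  inv_mem' := by
    intro f (hf : f.1 u = u)
    change f.1⁻¹ u = u
    rw [Equiv.Perm.inv_eq_iff_eq, hf]

/-- The stabilizer `st(L_n)` of the `n`-th level: the automorphisms that fix every word of
length `n`. -/
def levelStab {X : Type*} (n : ℕ) : Subgroup (AutTree X) :=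
  ⨅ u : {u : List X // u.length = n}, vertexStab u.1

/-- The homomorphism `ψ_u : st(u) → Aut T` that sends `g` to its section at `u`. -/
def psi {X : Type*} (u : List X) : vertexStab u →* AutTree X where
  toFun g := sect g.1 u
  map_one' := by
    apply Subtype.ext
    ext1 v
    change (u ++ v).drop u.length = v
    simp
  map_mul' f g := by
    apply Subtype.ext
    ext1 v
    have hg : g.1.1 u = u := g.2
    have h := apply_append_sect g.1 u v
    rw [hg] at h
    change (f.1.1 (g.1.1 (u ++ v))).drop u.length = (f.1.1 (u ++ (sect g.1 u).1 v)).drop u.length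
    rw [h]

/-- The image `ψ_u(st_G(L_n))`, for a vertex `u` of length `n`. -/
def levelImage {X : Type*} (G : Subgroup (AutTree X)) (n : ℕ) (u : List X) :
    Subgroup (AutTree X) :=
  ((G ⊓ levelStab n).subgroupOf (vertexStab u)).map (psi u)

/-- `G` is self-similar: all sections of elements of `G` lie in `G`. -/
def SelfSimilar {X : Type*} (G : Subgroup (AutTree X)) : Prop :=
  ∀ g ∈ G, ∀ u : List X, sect g u ∈ G

/-- `G` is strongly fractal: it is self-similar and `ψ_x(st_G(L_1)) = G` for all `x ∈ X`. -/
def StronglyFractal {X : Type*} (G : Subgroup (AutTree X)) : Prop :=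
  SelfSimilar G ∧ ∀ x : X, levelImage G 1 [x] = G

/-- `G` is super strongly fractal: it is self-similar and `ψ_u(st_G(L_n)) = G` for all `n` and all
`u ∈ L_n`. -/
def SuperStronglyFractal {X : Type*} (G : Subgroup (AutTree X)) : Prop :=
  SelfSimilar G ∧ ∀ (n : ℕ) (u : List X), u.length = n → levelImage G n u = G

/-- The map `xw ↦ σ(x)w`. -/
def rootedFun {X : Type*} (σ : Equiv.Perm X) : List X → List X
  | [] => []
  | x :: w => σ x :: w

/-- The rooted automorphism corresponding to the permutation `σ` of the alphabet. -/
def rooted {X : Type*} (σ : Equiv.Perm X) : AutTree X :=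
  ⟨⟨rootedFun σ, rootedFun σ⁻¹, by intro u; cases u <;> simp [rootedFun],
      by intro u; cases u <;> simp [rootedFun]⟩,
    mem_autTree_of_child _ rfl (by
      intro u x
      cases u with
      | nil => exact ⟨σ x, rfl⟩
      | cons y w => exact ⟨x, rfl⟩)⟩

/-- The map that fixes the first letter `x` of a word and acts on the rest of the word by `k_x` if
`x` is one of the first `d - 1` letters, and recursively by the map itself if `x` is the last
letter. -/
def directedFun {d : ℕ} (k : Fin (d - 1) → AutTree (Fin d)) : List (Fin d) → List (Fin d)
  | [] => []
  | x :: w => if h : x.1 < d - 1 then x :: (k ⟨x.1, h⟩).1 w else x :: directedFun k w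

theorem directedFun_inv {d : ℕ} (k l : Fin (d - 1) → AutTree (Fin d)) (h : ∀ i, k i * l i = 1)
    (u : List (Fin d)) : directedFun k (directedFun l u) = u := by
  induction u with
  | nil => rfl
  | cons x w ih =>
    by_cases hx : x.1 < d - 1
    · have := congrArg (fun g : AutTree (Fin d) => g.1 w) (h ⟨x.1, hx⟩)
      simpa [directedFun, hx] using this
    · simp [directedFun, hx, ih]

/-- The automorphism `b ∈ st(L_1)` with `ψ(b) = (k_1, …, k_{d-1}, b)`. -/
def directed {d : ℕ} (k : Fin (d - 1) → AutTree (Fin d)) : AutTree (Fin d) :=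
  ⟨⟨directedFun k, directedFun k⁻¹, directedFun_inv _ _ (by simp),
      directedFun_inv _ _ (by simp)⟩,
    mem_autTree_of_child _ rfl (by
      intro u
      change ∀ x, ∃ y, directedFun k (u ++ [x]) = directedFun k u ++ [y]
      induction u with
      | nil =>
        intro x
        by_cases hx : x.1 < d - 1
        · exact ⟨x, by simp [directedFun, hx, apply_nil]⟩
        · exact ⟨x, by simp [directedFun, hx]⟩
      | cons z w ih =>
        intro x
        by_cases hz : z.1 < d - 1
        · obtain ⟨y, hy⟩ := apply_child (k ⟨z.1, hz⟩) w x
          exact ⟨y, by simp [directedFun, hz, hy]⟩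
        · obtain ⟨y, hy⟩ := ih x
          exact ⟨y, by simp [directedFun, hz, hy]⟩)⟩

/-- The normal closure `⟨S⟩^G` in the subgroup `G` of a subset `S` of `G`, again as a subgroup of
`Aut T`. -/
def normalClosureIn {X : Type*} (G : Subgroup (AutTree X)) (S : Set (AutTree X)) :
    Subgroup (AutTree X) :=
  (Subgroup.normalClosure (G.subtype ⁻¹' S)).map G.subtype

end AutTree

namespace GGS

/-- The generator `a`: the rooted automorphism corresponding to the cycle `(1 2 … d)`. -/
def a (d : ℕ) : AutTree (Fin d) := AutTree.rooted (finRotate d)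

/-- The generator `b` with defining vector `e`: it lies in `st(L_1)` and
`ψ(b) = (a^{e_1}, …, a^{e_{d-1}}, b)`. -/
def b {d : ℕ} (e : Fin (d - 1) → ZMod d) : AutTree (Fin d) :=
  AutTree.directed fun i => a d ^ (e i).val

/-- The group `⟨a, b⟩`; it is the GGS-group with defining vector `e` when `e` is non-zero. -/
def group {d : ℕ} (e : Fin (d - 1) → ZMod d) : Subgroup (AutTree (Fin d)) :=
  Subgroup.closure {a d, b e}

theorem b_apply_singleton {d : ℕ} (e : Fin (d - 1) → ZMod d) (x : Fin d) : (b e).1 [x] = [x] := by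
  change AutTree.directedFun _ [x] = [x]
  by_cases h : x.1 < d - 1
  · simpa [AutTree.directedFun, h] using AutTree.apply_nil (a d ^ (e ⟨x.1, h⟩).val)
  · simp [AutTree.directedFun, h]

theorem section_b_of_lt {d : ℕ} (e : Fin (d - 1) → ZMod d) (x : Fin d) (h : x.1 < d - 1) :
    AutTree.sect (b e) [x] = a d ^ (e ⟨x.1, h⟩).val := by
  apply Subtype.ext
  ext1 v
  change (AutTree.directedFun _ (x :: v)).drop 1 = _
  simp [AutTree.directedFun, h]

theorem section_b_last {d : ℕ} (e : Fin (d - 1) → ZMod d) (x : Fin d) (h : ¬ x.1 < d - 1) :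
    AutTree.sect (b e) [x] = b e := by
  apply Subtype.ext
  ext1 v
  change (AutTree.directedFun _ (x :: v)).drop 1 = AutTree.directedFun _ v
  simp [AutTree.directedFun, h]

end GGS

/-! ### Sections, level stabilizers and normal closures in the automorphism group of the tree -/

namespace AutTree

variable {X : Type*}

/-! Since `c` is invertible mod `p`, the directed generators for `(c, …, c)` and `(1, …, 1)` are
powers of each other, so one may take `c = 1`. Write `b = (a, …, a, b)` and `G = ⟨a, b⟩`; from here
on only `p = n + 2 ≥ 2` matters.

Two homomorphisms from `G` to the integers mod `p` carry the proof: `rot`, the exponent sum of `a`,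
and `bExp`, that of `b`. Their sum `totalExp` takes the value 1 on both generators. Every
first-level section of `b` is `a` or `b`, and those of `a` are trivial, so the total exponent of any
first-level section of `g` equals `bExp g` (`totalExp_sect`). The kernel of `totalExp` is the normal
closure of `b⁻¹a` (`mem_diffClosure_iff`), which is proper because `a` has total exponent 1.

If `g` fixes the second level, its first-level sections have rotation 0. Since `bExp g` is minus the
sum of these rotations, it vanishes; two uses of `totalExp_sect` then put the section at `x₁x₁` in
the kernel (`levelImage_two_le`). Conversely, a commutator of `b` with the inverse of its conjugate
`(b, a, …, a)` fixes the second level and has section `b⁻¹a` at `x₁x₁`; strong fractality makes the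
image normal in `G`, so it contains the whole normal closure (`le_levelImage_two`). -/

theorem ext_apply {f g : AutTree X} (h : ∀ u, f.1 u = g.1 u) : f = g :=
  Subtype.ext (Equiv.ext h)

theorem mul_apply (f g : AutTree X) (u : List X) : (f * g).1 u = f.1 (g.1 u) := rfl

theorem inv_apply_eq_iff {g : AutTree X} {u v : List X} : g⁻¹.1 u = v ↔ u = g.1 v :=
  Equiv.Perm.inv_eq_iff_eq

theorem sect_one (u : List X) : sect (1 : AutTree X) u = 1 :=
  ext_apply fun v => by
    change (u ++ v).drop u.length = v
    simp

theorem sect_mul (f g : AutTree X) (u : List X) :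
    sect (f * g) u = sect f (g.1 u) * sect g u :=
  ext_apply fun v => by
    refine List.append_cancel_left (as := f.1 (g.1 u)) ?_
    have h := apply_append_sect (f * g) u v
    rw [mul_apply, mul_apply, apply_append_sect g, apply_append_sect f] at h
    exact h.symm

theorem sect_inv (g : AutTree X) (u : List X) : sect g⁻¹ u = (sect g (g⁻¹.1 u))⁻¹ := by
  have h := sect_mul g g⁻¹ u
  rw [mul_inv_cancel, sect_one] at h
  exact (inv_eq_of_mul_eq_one_right h.symm).symm

theorem sect_append (g : AutTree X) (u v : List X) : sect g (u ++ v) = sect (sect g u) v :=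
  ext_apply fun w => by
    refine List.append_cancel_left (as := g.1 (u ++ v)) ?_
    rw [← apply_append_sect, List.append_assoc, apply_append_sect g u (v ++ w),
      apply_append_sect (sect g u) v w, apply_append_sect g u v, List.append_assoc]

theorem sect_nil (g : AutTree X) : sect g [] = g := ext_apply fun _ => rfl

theorem mem_levelStab {n : ℕ} {g : AutTree X} :
    g ∈ levelStab n ↔ ∀ u : List X, u.length = n → g.1 u = u := by
  simp only [levelStab, Subgroup.mem_iInf, Subtype.forall]
  rfl

theorem mem_levelImage {G : Subgroup (AutTree X)} {n : ℕ} {u : List X} (hu : u.length = n)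
    {k : AutTree X} : k ∈ levelImage G n u ↔ ∃ g ∈ G, g ∈ levelStab n ∧ sect g u = k := by
  constructor
  · rintro ⟨g, hg, rfl⟩
    exact ⟨g.1, hg.1, hg.2, rfl⟩
  · rintro ⟨g, hg, hs, rfl⟩
    exact ⟨⟨g, mem_levelStab.1 hs u hu⟩, ⟨hg, hs⟩, rfl⟩

theorem mem_levelStab_one {g : AutTree X} : g ∈ levelStab 1 ↔ ∀ x : X, g.1 [x] = [x] := by
  rw [mem_levelStab]
  constructor
  · exact fun h x => h [x] rfl
  · intro h u hu
    obtain ⟨x, rfl⟩ := List.length_eq_one_iff.1 hu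
    exact h x

theorem mem_levelStab_succ {n : ℕ} {g : AutTree X} (h1 : g ∈ levelStab 1) :
    g ∈ levelStab (n + 1) ↔ ∀ x : X, sect g [x] ∈ levelStab n := by
  simp only [mem_levelStab]
  have key : ∀ x u, g.1 (x :: u) = x :: (sect g [x]).1 u := fun x u => by
    have h := apply_append_sect g [x] u
    rwa [mem_levelStab_one.1 h1 x] at h
  constructor
  · intro h x u hu
    have := h (x :: u) (by simp [hu])
    rw [key] at this
    exact List.tail_eq_of_cons_eq this
  · rintro h (_ | ⟨x, u⟩) hu
    · simp at hu
    · rw [key, h x u (by simpa using hu)]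

theorem levelStab_succ_le [Nonempty X] (n : ℕ) :
    levelStab (X := X) (n + 1) ≤ levelStab n := by
  intro g hg
  rw [mem_levelStab] at *
  intro u hu
  obtain ⟨x⟩ := ‹Nonempty X›
  have h := hg (u ++ [x]) (by simp [hu])
  rw [apply_append_sect] at h
  exact List.append_inj_left h (length_apply g u)

theorem conj_mem_levelStab {n : ℕ} (f : AutTree X) {g : AutTree X} (hg : g ∈ levelStab n) :
    f * g * f⁻¹ ∈ levelStab n := by
  rw [mem_levelStab] at *
  intro u hu
  rw [mul_apply, mul_apply, hg _ (by rw [length_apply, hu])]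
  exact Equiv.apply_symm_apply f.1 u

theorem selfSimilar_of_letters {G : Subgroup (AutTree X)}
    (h : ∀ g ∈ G, ∀ x : X, sect g [x] ∈ G) : SelfSimilar G := by
  intro g hg u
  induction u generalizing g with
  | nil => rwa [sect_nil]
  | cons x u ih =>
    rw [← List.singleton_append, sect_append]
    exact ih _ (h g hg x)

/-- If every element of `G` is the section at `u` of an element of `G` fixing `u`, then `G`
normalizes `levelImage G n u`. -/
theorem conj_mem_levelImage {G : Subgroup (AutTree X)} {n : ℕ} {u : List X} (hu : u.length = n)
    (hG : ∀ h ∈ G, ∃ f ∈ G, f.1 u = u ∧ sect f u = h) {h k : AutTree X} (hh : h ∈ G)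
    (hk : k ∈ levelImage G n u) : h * k * h⁻¹ ∈ levelImage G n u := by
  rw [mem_levelImage hu] at *
  obtain ⟨g, hg, hs, rfl⟩ := hk
  obtain ⟨f, hf, hfu, rfl⟩ := hG h hh
  have hfu' : f⁻¹.1 u = u := inv_apply_eq_iff.2 hfu.symm
  refine ⟨f * g * f⁻¹, mul_mem (mul_mem hf hg) (inv_mem hf), conj_mem_levelStab f hs, ?_⟩
  rw [sect_mul, sect_mul, sect_inv, hfu', mem_levelStab.1 hs u hu]

theorem subset_normalClosureIn {G : Subgroup (AutTree X)} {S : Set (AutTree X)}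
    (hS : S ⊆ G) : S ⊆ normalClosureIn G S :=
  fun s hs => ⟨⟨s, hS hs⟩, Subgroup.subset_normalClosure hs, rfl⟩

theorem normalClosureIn_le_self (G : Subgroup (AutTree X)) (S : Set (AutTree X)) :
    normalClosureIn G S ≤ G := by
  rintro _ ⟨g, -, rfl⟩
  exact g.2

theorem conj_mem_normalClosureIn {G : Subgroup (AutTree X)} {S : Set (AutTree X)}
    {h k : AutTree X} (hh : h ∈ G) (hk : k ∈ normalClosureIn G S) :
    h * k * h⁻¹ ∈ normalClosureIn G S := by
  obtain ⟨g, hg, rfl⟩ := hk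
  exact ⟨⟨h, hh⟩ * g * ⟨h, hh⟩⁻¹, Subgroup.normalClosure_normal.conj_mem g hg _, rfl⟩

theorem normalClosureIn_le {G H : Subgroup (AutTree X)} {S : Set (AutTree X)} (hS : S ⊆ H)
    (hH : ∀ h ∈ G, ∀ k ∈ H, h * k * h⁻¹ ∈ H) : normalClosureIn G S ≤ H := by
  have : (H.subgroupOf G).Normal := ⟨fun k hk h => hH h.1 h.2 k.1 hk⟩
  have key : Subgroup.normalClosure (G.subtype ⁻¹' S) ≤ H.subgroupOf G :=
    Subgroup.normalClosure_le_normal fun s hs => hS hs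
  rintro _ ⟨g, hg, rfl⟩
  exact key hg

/-! ### Products and powers of rooted and directed automorphisms -/

theorem sect_rooted (σ : Equiv.Perm X) (x : X) : sect (rooted σ) [x] = 1 :=
  ext_apply fun _ => rfl

theorem rooted_apply_singleton (σ : Equiv.Perm X) (x : X) : (rooted σ).1 [x] = [σ x] := rfl

theorem rooted_mul (σ τ : Equiv.Perm X) : rooted (σ * τ) = rooted σ * rooted τ :=
  ext_apply fun u => by cases u <;> rfl

theorem rooted_one : rooted (1 : Equiv.Perm X) = 1 :=
  ext_apply fun u => by cases u <;> rfl

theorem rooted_pow (σ : Equiv.Perm X) (k : ℕ) : rooted σ ^ k = rooted (σ ^ k) := by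
  induction k with
  | zero => rw [pow_zero, pow_zero, rooted_one]
  | succ k ih => rw [pow_succ, pow_succ, rooted_mul, ih]

theorem directed_mul {d : ℕ} (k l : Fin (d - 1) → AutTree (Fin d)) :
    directed (k * l) = directed k * directed l :=
  ext_apply fun u => by
    change directedFun (k * l) u = directedFun k (directedFun l u)
    induction u with
    | nil => rfl
    | cons x w ih =>
      by_cases hx : x.1 < d - 1
      · simp [directedFun, hx]
      · simp [directedFun, hx, ih]

theorem directed_one {d : ℕ} : directed (1 : Fin (d - 1) → AutTree (Fin d)) = 1 :=
  ext_apply fun u => by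
    change directedFun 1 u = u
    induction u with
    | nil => rfl
    | cons x w ih =>
      by_cases hx : x.1 < d - 1
      · simp [directedFun, hx]
      · simp [directedFun, hx, ih]

theorem directed_pow {d : ℕ} (k : Fin (d - 1) → AutTree (Fin d)) (m : ℕ) :
    directed k ^ m = directed (k ^ m) := by
  induction m with
  | zero => rw [pow_zero, pow_zero, directed_one]
  | succ m ih => rw [pow_succ, pow_succ, directed_mul, ih]

end AutTree

namespace GGS

open AutTree
open scoped commutatorElement

variable {n : ℕ}

/-! ### The generators and their first-level sections -/

theorem a_pow_self (n : ℕ) : a (n + 2) ^ (n + 2) = 1 := by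
  have h : finRotate (n + 2) ^ (n + 2) = 1 := by
    have := pow_orderOf_eq_one (finRotate (n + 2))
    rwa [isCycle_finRotate.orderOf, support_finRotate, Finset.card_univ, Fintype.card_fin] at this
  rw [a, rooted_pow, h, rooted_one]

theorem a_pow_val_cast (k : ℕ) :
    a (n + 2) ^ (k : ZMod (n + 2)).val = a (n + 2) ^ k := by
  rw [ZMod.val_natCast]
  exact (pow_eq_pow_mod k (a_pow_self n)).symm

theorem b_const_pow (c : ZMod (n + 2)) (k : ℕ) :
    b (fun _ : Fin (n + 2 - 1) => c) ^ k = b (fun _ : Fin (n + 2 - 1) => c * k) := by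
  rw [b, b, directed_pow]
  congr 1
  funext i
  rw [Pi.pow_apply, ← pow_mul, ← a_pow_val_cast, Nat.cast_mul, ZMod.natCast_zmod_val]

/-- The directed generator with defining vector `(1, …, 1)`. -/
abbrev constB (n : ℕ) : AutTree (Fin (n + 2)) :=
  b (1 : Fin (n + 2 - 1) → ZMod (n + 2))

/-- The GGS-group with defining vector `(1, …, 1)`. -/
abbrev constGroup (n : ℕ) : Subgroup (AutTree (Fin (n + 2))) :=
  group (1 : Fin (n + 2 - 1) → ZMod (n + 2))

theorem a_mem_group {d : ℕ} (e : Fin (d - 1) → ZMod d) : a d ∈ group e :=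
  Subgroup.subset_closure (Set.mem_insert _ _)

theorem b_mem_group {d : ℕ} (e : Fin (d - 1) → ZMod d) : b e ∈ group e :=
  Subgroup.subset_closure (Set.mem_insert_of_mem _ rfl)

theorem a_apply_singleton (x : Fin (n + 2)) : (a (n + 2)).1 [x] = [x + 1] := by
  rw [a, rooted_apply_singleton, finRotate_apply]

theorem a_inv_apply_singleton (x : Fin (n + 2)) : (a (n + 2))⁻¹.1 [x] = [x - 1] := by
  rw [inv_apply_eq_iff, a_apply_singleton, sub_add_cancel]

theorem sect_a (x : Fin (n + 2)) : sect (a (n + 2)) [x] = 1 := sect_rooted _ x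

theorem sect_a_inv (x : Fin (n + 2)) : sect (a (n + 2))⁻¹ [x] = 1 := by
  rw [sect_inv, a_inv_apply_singleton, sect_a, inv_one]

theorem sect_constB_of_ne {x : Fin (n + 2)} (hx : x ≠ Fin.last (n + 1)) :
    sect (constB n) [x] = a (n + 2) := by
  refine (section_b_of_lt _ _ (Fin.lt_last_iff_ne_last.2 hx)).trans ?_
  change a (n + 2) ^ (1 : ZMod (n + 2)).val = _
  rw [ZMod.val_one'' (by lia), pow_one]

theorem sect_constB_last : sect (constB n) [Fin.last (n + 1)] = constB n :=
  section_b_last _ _ (by simp)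

theorem constB_apply_singleton (x : Fin (n + 2)) : (constB n).1 [x] = [x] :=
  b_apply_singleton _ x

/-! ### Exponent homomorphisms on the group -/

/-- The rotation by which an element of `constGroup n` acts on the first level. -/
def rot (g : AutTree (Fin (n + 2))) : Fin (n + 2) := (g.1 [0]).headD 0

theorem rot_eq_of_apply {g : AutTree (Fin (n + 2))} {k : Fin (n + 2)}
    (h : ∀ x, g.1 [x] = [x + k]) : rot g = k := by
  rw [rot, h, List.headD_cons, zero_add]

theorem apply_singleton {g : AutTree (Fin (n + 2))} (hg : g ∈ constGroup n) (x : Fin (n + 2)) :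
    g.1 [x] = [x + rot g] := by
  suffices h : ∃ k, ∀ x, g.1 [x] = [x + k] by
    obtain ⟨k, h⟩ := h
    rw [rot_eq_of_apply h, h]
  clear x
  induction hg using Subgroup.closure_induction with
  | mem g hg =>
    rcases hg with rfl | rfl
    · exact ⟨1, a_apply_singleton⟩
    · exact ⟨0, fun x => by rw [constB_apply_singleton, add_zero]⟩
  | one => exact ⟨0, fun x => by rw [add_zero]; rfl⟩
  | mul f g _ _ hf hg =>
    obtain ⟨k, hk⟩ := hf
    obtain ⟨l, hl⟩ := hg
    exact ⟨l + k, fun x => by rw [mul_apply, hl, hk, add_assoc]⟩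
  | inv f _ hf =>
    obtain ⟨k, hk⟩ := hf
    exact ⟨-k, fun x => by rw [inv_apply_eq_iff, hk, neg_add_cancel_right]⟩

theorem rot_mul {f g : AutTree (Fin (n + 2))} (hf : f ∈ constGroup n) (hg : g ∈ constGroup n) :
    rot (f * g) = rot f + rot g :=
  rot_eq_of_apply fun x => by
    rw [mul_apply, apply_singleton hg, apply_singleton hf, add_assoc, add_comm (rot f)]

theorem rot_one : rot (1 : AutTree (Fin (n + 2))) = 0 := rfl

theorem rot_a : rot (a (n + 2)) = 1 := rot_eq_of_apply a_apply_singleton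

theorem rot_constB : rot (constB n) = 0 :=
  rot_eq_of_apply fun x => by rw [constB_apply_singleton, add_zero]

theorem mem_levelStab_one_iff {g : AutTree (Fin (n + 2))} (hg : g ∈ constGroup n) :
    g ∈ levelStab 1 ↔ rot g = 0 := by
  rw [mem_levelStab_one]
  constructor
  · exact fun h => rot_eq_of_apply fun x => by rw [h, add_zero]
  · intro h x
    rw [apply_singleton hg, h, add_zero]

theorem sect_singleton_mem {g : AutTree (Fin (n + 2))} (hg : g ∈ constGroup n)
    (x : Fin (n + 2)) : sect g [x] ∈ constGroup n := by
  induction hg using Subgroup.closure_induction generalizing x with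
  | mem g hg =>
    rcases hg with rfl | rfl
    · rw [sect_a]
      exact one_mem _
    · by_cases hx : x = Fin.last (n + 1)
      · rw [hx, sect_constB_last]
        exact b_mem_group _
      · rw [sect_constB_of_ne hx]
        exact a_mem_group _
  | one =>
    rw [sect_one]
    exact one_mem _
  | mul f g _ hg' hf hg =>
    rw [sect_mul, apply_singleton hg']
    exact mul_mem (hf _) (hg _)
  | inv f hf' hf =>
    rw [sect_inv, apply_singleton (inv_mem hf')]
    exact inv_mem (hf _)

/-- The exponent sum of `constB n` in an element of `constGroup n`, read off from the action on
the second level. -/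
def bExp (g : AutTree (Fin (n + 2))) : Fin (n + 2) := -∑ x, rot (sect g [x])

/-- The first-level sections of `f * g` pair those of `g` with those of `f` translated by `rot g`,
and a translation of the letters does not change the sum. -/
theorem bExp_mul {f g : AutTree (Fin (n + 2))} (hf : f ∈ constGroup n) (hg : g ∈ constGroup n) :
    bExp (f * g) = bExp f + bExp g := by
  have h : ∀ x, rot (sect (f * g) [x]) = rot (sect f [x + rot g]) + rot (sect g [x]) := fun x => by
    rw [sect_mul, apply_singleton hg,
      rot_mul (sect_singleton_mem hf _) (sect_singleton_mem hg _)]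
  rw [bExp, Finset.sum_congr rfl fun x _ => h x, Finset.sum_add_distrib, neg_add, bExp, bExp]
  congr 2
  exact Equiv.sum_comp (Equiv.addRight (rot g)) fun x => rot (sect f [x])

theorem bExp_one : bExp (1 : AutTree (Fin (n + 2))) = 0 := by
  simp [bExp, sect_one, rot_one]

theorem bExp_a : bExp (a (n + 2)) = 0 := by
  simp [bExp, sect_a, rot_one]

/-- All `n + 1` sections before the last are `a` and the last has rotation 0, so the rotations sum
to `n + 1 = -1`; hence the sign in `bExp`. -/
theorem bExp_constB : bExp (constB n) = 1 := by
  have h : ∀ i : Fin (n + 1), rot (sect (constB n) [i.castSucc]) = 1 := fun i => by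
    rw [sect_constB_of_ne (Fin.castSucc_lt_last i).ne, rot_a]
  rw [bExp, Fin.sum_univ_castSucc, sect_constB_last, rot_constB, add_zero,
    Finset.sum_congr rfl fun i _ => h i, Finset.sum_const, Finset.card_univ, Fintype.card_fin,
    neg_eq_iff_add_eq_zero, ← succ_nsmul]
  -- `Fin (n + 2)` and `ZMod (n + 2)` agree definitionally.
  exact (nsmul_one (A := ZMod (n + 2)) (n + 2)).trans (ZMod.natCast_self (n + 2))

/-- The sum of the exponent sums of `a` and `constB n` in an element of `constGroup n`. -/
def totalExp (g : AutTree (Fin (n + 2))) : Fin (n + 2) := rot g + bExp g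

theorem totalExp_mul {f g : AutTree (Fin (n + 2))} (hf : f ∈ constGroup n)
    (hg : g ∈ constGroup n) : totalExp (f * g) = totalExp f + totalExp g := by
  rw [totalExp, rot_mul hf hg, bExp_mul hf hg, add_add_add_comm, totalExp, totalExp]

theorem totalExp_one : totalExp (1 : AutTree (Fin (n + 2))) = 0 := by
  rw [totalExp, rot_one, bExp_one, add_zero]

theorem totalExp_a : totalExp (a (n + 2)) = 1 := by rw [totalExp, rot_a, bExp_a, add_zero]

theorem totalExp_constB : totalExp (constB n) = 1 := by
  rw [totalExp, rot_constB, bExp_constB, zero_add]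

/-- The exponent maps are defined on all tree automorphisms but shown additive only on the subgroup.
-/
theorem map_inv_of_map_mul {G A : Type*} [Group G] [AddGroup A] {H : Subgroup G} {f : G → A}
    (h1 : f 1 = 0) (hmul : ∀ {x y}, x ∈ H → y ∈ H → f (x * y) = f x + f y) {x : G} (hx : x ∈ H) :
    f x⁻¹ = -f x := by
  rw [eq_neg_iff_add_eq_zero, ← hmul (inv_mem hx) hx, inv_mul_cancel, h1]

theorem rot_inv {g : AutTree (Fin (n + 2))} (hg : g ∈ constGroup n) : rot g⁻¹ = -rot g :=
  map_inv_of_map_mul rot_one rot_mul hg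

theorem bExp_inv {g : AutTree (Fin (n + 2))} (hg : g ∈ constGroup n) : bExp g⁻¹ = -bExp g :=
  map_inv_of_map_mul bExp_one bExp_mul hg

theorem totalExp_inv {g : AutTree (Fin (n + 2))} (hg : g ∈ constGroup n) :
    totalExp g⁻¹ = -totalExp g :=
  map_inv_of_map_mul totalExp_one totalExp_mul hg

/-- Both sides are additive in `g`, and the value does not depend on the letter, so permuting
letters does no harm. On generators: sections of `b` are `a` or `b`, each of total exponent 1, and
sections of `a` are trivial. -/
theorem totalExp_sect {g : AutTree (Fin (n + 2))} (hg : g ∈ constGroup n) (x : Fin (n + 2)) :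
    totalExp (sect g [x]) = bExp g := by
  induction hg using Subgroup.closure_induction generalizing x with
  | mem g hg =>
    rcases hg with rfl | rfl
    · rw [sect_a, bExp_a, totalExp_one]
    · by_cases hx : x = Fin.last (n + 1)
      · rw [hx, sect_constB_last, totalExp_constB, bExp_constB]
      · rw [sect_constB_of_ne hx, totalExp_a, bExp_constB]
  | one => rw [sect_one, totalExp_one, bExp_one]
  | mul f g hf' hg' hf hg =>
    rw [sect_mul, apply_singleton hg',
      totalExp_mul (sect_singleton_mem hf' _) (sect_singleton_mem hg' _), hf, hg,
      bExp_mul hf' hg']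
  | inv f hf' hf =>
    rw [sect_inv, apply_singleton (inv_mem hf'), totalExp_inv (sect_singleton_mem hf' _), hf,
      bExp_inv hf']

theorem selfSimilar_constGroup : SelfSimilar (constGroup n) :=
  selfSimilar_of_letters fun _ hg x => sect_singleton_mem hg x

/-! ### The kernel of the total exponent -/

/-- The normal closure of `b⁻¹ * a` in `constGroup n`. -/
abbrev diffClosure (n : ℕ) : Subgroup (AutTree (Fin (n + 2))) :=
  normalClosureIn (constGroup n) {(constB n)⁻¹ * a (n + 2)}

theorem constB_inv_mul_a_mem : (constB n)⁻¹ * a (n + 2) ∈ constGroup n :=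
  mul_mem (inv_mem (b_mem_group _)) (a_mem_group _)

theorem totalExp_a_pow (j : ℕ) : totalExp (a (n + 2) ^ j) = j • (1 : Fin (n + 2)) := by
  induction j with
  | zero => rw [pow_zero, totalExp_one, zero_nsmul]
  | succ j ih =>
    rw [pow_succ, totalExp_mul (pow_mem (a_mem_group _) j) (a_mem_group _), ih, totalExp_a,
      succ_nsmul]

/-- The normal closure of `b⁻¹ * a` consists of the elements with vanishing total exponent sum. -/
theorem mem_diffClosure_iff {g : AutTree (Fin (n + 2))} :
    g ∈ diffClosure n ↔ g ∈ constGroup n ∧ totalExp g = 0 := by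
  have le_ker : ∀ {g}, g ∈ diffClosure n → g ∈ constGroup n ∧ totalExp g = 0 := by
    intro g hg
    let H : Subgroup (AutTree (Fin (n + 2))) :=
      { carrier := {g | g ∈ constGroup n ∧ totalExp g = 0}
        one_mem' := ⟨one_mem _, totalExp_one⟩
        mul_mem' := fun hf hg =>
          ⟨mul_mem hf.1 hg.1, by rw [totalExp_mul hf.1 hg.1, hf.2, hg.2, add_zero]⟩
        inv_mem' := fun hf => ⟨inv_mem hf.1, by rw [totalExp_inv hf.1, hf.2, neg_zero]⟩ }
    have h : diffClosure n ≤ H := by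
      refine normalClosureIn_le (Set.singleton_subset_iff.2 ⟨constB_inv_mul_a_mem, ?_⟩) ?_
      · rw [totalExp_mul (inv_mem (b_mem_group _)) (a_mem_group _), totalExp_inv (b_mem_group _),
          totalExp_a, totalExp_constB, neg_add_cancel]
      · intro h hh k hk
        refine ⟨mul_mem (mul_mem hh hk.1) (inv_mem hh), ?_⟩
        rw [totalExp_mul (mul_mem hh hk.1) (inv_mem hh), totalExp_mul hh hk.1, hk.2,
          totalExp_inv hh, add_zero, add_neg_cancel]
    exact h hg
  refine ⟨le_ker, ?_⟩
  rintro ⟨hg, hg0⟩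
  have ha : ∀ m : ℤ, a (n + 2) ^ m ∈ constGroup n := fun m => zpow_mem (a_mem_group _) m
  -- Modulo the normal closure `b` equals `a`, so the quotient is generated by the image of `a`.
  have key : ∃ m : ℤ, ∃ k ∈ diffClosure n, g = a (n + 2) ^ m * k := by
    clear hg0
    induction hg using Subgroup.closure_induction with
    | mem g hg =>
      rcases hg with rfl | rfl
      · exact ⟨1, 1, one_mem _, by group⟩
      · refine ⟨1, ((constB n)⁻¹ * a (n + 2))⁻¹, inv_mem ?_, by group⟩
        exact subset_normalClosureIn (Set.singleton_subset_iff.2 constB_inv_mul_a_mem) rfl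
    | one => exact ⟨0, 1, one_mem _, by group⟩
    | mul f g _ _ hf hg =>
      obtain ⟨m, k, hk, rfl⟩ := hf
      obtain ⟨l, k', hk', rfl⟩ := hg
      exact ⟨m + l, _, mul_mem (conj_mem_normalClosureIn (ha (-l)) hk) hk', by group⟩
    | inv f _ hf =>
      obtain ⟨m, k, hk, rfl⟩ := hf
      exact ⟨-m, _, conj_mem_normalClosureIn (ha m) (inv_mem hk), by group⟩
  obtain ⟨m, k, hk, rfl⟩ := key
  have hfin : IsOfFinOrder (a (n + 2)) := isOfFinOrder_iff_pow_eq_one.2 ⟨_, by simp, a_pow_self n⟩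
  obtain ⟨j, hj⟩ : ∃ j : ℕ, a (n + 2) ^ j = a (n + 2) ^ m :=
    hfin.mem_powers_iff_mem_zpowers.2 ⟨m, rfl⟩
  rw [totalExp_mul (ha m) (normalClosureIn_le_self _ _ hk), (le_ker hk).2, add_zero, ← hj,
    totalExp_a_pow] at hg0
  -- The total exponent of the element is `j` mod `n + 2`; its vanishing makes the power of `a`
  -- trivial.
  have hdvd : n + 2 ∣ j := (ZMod.natCast_eq_zero_iff _ _).1
    ((nsmul_one (A := ZMod (n + 2)) j).symm.trans hg0)
  obtain ⟨q, rfl⟩ := hdvd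
  rwa [← hj, pow_mul, a_pow_self, one_pow, one_mul]

/-! ### Strong fractality -/

/-- The conjugate of `constB n` whose section at the first letter is `constB n`. -/
abbrev conjB (n : ℕ) : AutTree (Fin (n + 2)) := a (n + 2) * constB n * (a (n + 2))⁻¹

theorem conjB_mem : conjB n ∈ constGroup n :=
  mul_mem (mul_mem (a_mem_group _) (b_mem_group _)) (inv_mem (a_mem_group _))

theorem constB_mem_levelStab : constB n ∈ levelStab 1 :=
  mem_levelStab_one.2 constB_apply_singleton

theorem sect_a_conj {g : AutTree (Fin (n + 2))} (hg : g ∈ levelStab 1) (x : Fin (n + 2)) :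
    sect (a (n + 2) * g * (a (n + 2))⁻¹) [x] = sect g [x - 1] := by
  rw [sect_mul, sect_mul, sect_a_inv, a_inv_apply_singleton, mem_levelStab_one.1 hg, sect_a,
    one_mul, mul_one]

theorem sect_constB_zero : sect (constB n) [0] = a (n + 2) :=
  sect_constB_of_ne (Fin.last_pos).ne

theorem sect_conjB_zero : sect (conjB n) [0] = constB n := by
  rw [sect_a_conj constB_mem_levelStab, zero_sub,
    ← eq_neg_of_add_eq_zero_left (Fin.last_add_one (n + 1)), sect_constB_last]

theorem levelImage_one_le_add_one (x : Fin (n + 2)) :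
    levelImage (constGroup n) 1 [x] ≤ levelImage (constGroup n) 1 [x + 1] := by
  intro k hk
  obtain ⟨g, hg, hs, rfl⟩ := (mem_levelImage rfl).1 hk
  refine (mem_levelImage rfl).2 ⟨_, mul_mem (mul_mem (a_mem_group _) hg)
    (inv_mem (a_mem_group _)), conj_mem_levelStab _ hs, ?_⟩
  rw [sect_a_conj hs, add_sub_cancel_right]

theorem stronglyFractal_constGroup : StronglyFractal (constGroup n) := by
  refine ⟨selfSimilar_constGroup, fun x => le_antisymm ?_ ?_⟩
  · intro k hk
    obtain ⟨g, hg, -, rfl⟩ := (mem_levelImage rfl).1 hk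
    exact sect_singleton_mem hg x
  -- At the first letter, `b` and its conjugate have sections `a` and `b`; conjugation by `a`
  -- carries the result to the next letter.
  · induction x using Fin.induction with
    | zero =>
      refine (Subgroup.closure_le _).2 ?_
      rintro _ (rfl | rfl)
      · exact (mem_levelImage rfl).2
          ⟨_, b_mem_group _, constB_mem_levelStab, sect_constB_zero⟩
      · exact (mem_levelImage rfl).2
          ⟨_, conjB_mem, conj_mem_levelStab _ constB_mem_levelStab, sect_conjB_zero⟩
    | succ i ih =>
      rw [← Fin.coeSucc_eq_succ]
      exact ih.trans (levelImage_one_le_add_one _)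

theorem exists_sect_singleton_eq {h : AutTree (Fin (n + 2))} (hh : h ∈ constGroup n)
    (x : Fin (n + 2)) : ∃ f ∈ constGroup n, f.1 [x] = [x] ∧ sect f [x] = h := by
  rw [← stronglyFractal_constGroup.2 x] at hh
  obtain ⟨f, hf, hs, hfx⟩ := (mem_levelImage rfl).1 hh
  exact ⟨f, hf, mem_levelStab_one.1 hs x, hfx⟩

theorem exists_sect_pair_eq {h : AutTree (Fin (n + 2))} (hh : h ∈ constGroup n)
    (x y : Fin (n + 2)) : ∃ f ∈ constGroup n, f.1 [x, y] = [x, y] ∧ sect f [x, y] = h := by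
  obtain ⟨k, hk, hky, rfl⟩ := exists_sect_singleton_eq hh y
  obtain ⟨f, hf, hfx, rfl⟩ := exists_sect_singleton_eq hk x
  refine ⟨f, hf, ?_, sect_append f [x] [y]⟩
  have := apply_append_sect f [x] [y]
  rwa [hfx, hky] at this

/-! ### The image of the second level stabilizer -/

theorem commutator_mem {G : Type*} [Group G] {H : Subgroup G} {f g : G} (hf : f ∈ H)
    (hg : g ∈ H) : ⁅f, g⁆ ∈ H :=
  mul_mem (mul_mem (mul_mem hf hg) (inv_mem hf)) (inv_mem hg)

theorem rot_commutator {f g : AutTree (Fin (n + 2))} (hf : f ∈ constGroup n)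
    (hg : g ∈ constGroup n) : rot ⁅f, g⁆ = 0 := by
  rw [commutatorElement_def, rot_mul (mul_mem (mul_mem hf hg) (inv_mem hf)) (inv_mem hg),
    rot_mul (mul_mem hf hg) (inv_mem hf), rot_mul hf hg, rot_inv hf, rot_inv hg]
  abel

theorem sect_commutator {f g : AutTree (Fin (n + 2))} (hf : f ∈ levelStab 1)
    (hg : g ∈ levelStab 1) (x : Fin (n + 2)) : sect ⁅f, g⁆ [x] = ⁅sect f [x], sect g [x]⁆ := by
  rw [commutatorElement_def, sect_mul, sect_mul, sect_mul, sect_inv, sect_inv,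
    mem_levelStab_one.1 (inv_mem hg),
    mem_levelStab_one.1 (inv_mem hf), mem_levelStab_one.1 hg, commutatorElement_def]

/-- The first-level sections are commutators in the group, which acts on the first level through an
abelian group of rotations. -/
theorem commutator_mem_levelStab_two {f g : AutTree (Fin (n + 2))} (hf : f ∈ constGroup n)
    (hg : g ∈ constGroup n) (hf1 : f ∈ levelStab 1) (hg1 : g ∈ levelStab 1) :
    ⁅f, g⁆ ∈ levelStab 2 := by
  refine (mem_levelStab_succ ?_).2 fun x => ?_
  · exact commutator_mem hf1 hg1
  · have hf' := sect_singleton_mem hf x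
    have hg' := sect_singleton_mem hg x
    rw [sect_commutator hf1 hg1]
    exact (mem_levelStab_one_iff (commutator_mem hf' hg')).2 (rot_commutator hf' hg')

theorem levelImage_two_le : levelImage (constGroup n) 2 [0, 0] ≤ diffClosure n := by
  intro k hk
  obtain ⟨g, hg, hs, rfl⟩ := (mem_levelImage rfl).1 hk
  have hx : ∀ x, sect g [x] ∈ constGroup n := sect_singleton_mem hg
  have hrot : ∀ x, rot (sect g [x]) = 0 := fun x =>
    (mem_levelStab_one_iff (hx x)).1 ((mem_levelStab_succ (levelStab_succ_le 1 hs)).1 hs x)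
  have hb : bExp g = 0 := by
    rw [bExp, Finset.sum_eq_zero fun x _ => hrot x, neg_zero]
  have hb0 : bExp (sect g [0]) = 0 := by
    have h := totalExp_sect hg 0
    rwa [totalExp, hrot, zero_add, hb] at h
  rw [show ([0, 0] : List (Fin (n + 2))) = [0] ++ [0] from rfl, sect_append]
  exact mem_diffClosure_iff.2
    ⟨sect_singleton_mem (hx 0) 0, (totalExp_sect (hx 0) 0).trans hb0⟩

theorem le_levelImage_two : diffClosure n ≤ levelImage (constGroup n) 2 [0, 0] := by
  refine normalClosureIn_le (Set.singleton_subset_iff.2 ?_) fun h hh k hk =>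
    conj_mem_levelImage rfl (fun _ hh => exists_sect_pair_eq hh 0 0) hh hk
  have hc1 : conjB n ∈ levelStab 1 := conj_mem_levelStab _ constB_mem_levelStab
  -- With `b = (a, …)` and `conjB n = (b, …)`, the section at the first letter is `⁅a, b⁻¹⁆ = (a b⁻¹
  -- a⁻¹) b = (conjB n)⁻¹ b`, whose own section there is `b⁻¹ a`.
  refine (mem_levelImage rfl).2 ⟨⁅constB n, (conjB n)⁻¹⁆,
    commutator_mem (b_mem_group _) (inv_mem conjB_mem),
    commutator_mem_levelStab_two (b_mem_group _) (inv_mem conjB_mem) constB_mem_levelStab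
      (inv_mem hc1), ?_⟩
  have h1 : sect ⁅constB n, (conjB n)⁻¹⁆ [0] = (conjB n)⁻¹ * constB n := by
    rw [sect_commutator constB_mem_levelStab (inv_mem hc1), sect_inv,
      mem_levelStab_one.1 (inv_mem hc1), sect_conjB_zero, sect_constB_zero]
    group
  rw [show ([0, 0] : List (Fin (n + 2))) = [0] ++ [0] from rfl, sect_append, h1, sect_mul,
    constB_apply_singleton, sect_inv, mem_levelStab_one.1 (inv_mem hc1), sect_conjB_zero,
    sect_constB_zero]

theorem levelImage_two : levelImage (constGroup n) 2 [0, 0] = diffClosure n :=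
  le_antisymm levelImage_two_le le_levelImage_two

theorem diffClosure_lt : diffClosure n < constGroup n := by
  refine lt_of_le_of_ne (normalClosureIn_le_self _ _) fun h => ?_
  have ha : a (n + 2) ∈ diffClosure n := h ▸ a_mem_group _
  have h0 := (mem_diffClosure_iff.1 ha).2
  rw [totalExp_a] at h0
  exact one_ne_zero h0

/-! ### Reduction to the vector `(1, …, 1)` -/

theorem exists_b_const_pow_eq {p : ℕ} [Fact p.Prime] {c d : ZMod p} (hc : c ≠ 0) :
    ∃ k : ℕ, b (fun _ : Fin (p - 1) => c) ^ k = b (fun _ : Fin (p - 1) => d) := by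
  obtain ⟨n, rfl⟩ := Nat.exists_eq_add_of_le' (Fact.out : p.Prime).two_le
  -- The `k`-th power multiplies the constant by `k`; primality makes `c` invertible.
  refine ⟨(c⁻¹ * d).val, ?_⟩
  rw [b_const_pow, ZMod.natCast_zmod_val, mul_inv_cancel_left₀ hc]

theorem group_le_of_pow {d : ℕ} {e e' : Fin (d - 1) → ZMod d} {k : ℕ} (h : b e ^ k = b e') :
    group e' ≤ group e := by
  refine (Subgroup.closure_le _).2 ?_
  rintro _ (rfl | rfl)
  · exact a_mem_group e
  · exact h ▸ pow_mem (b_mem_group e) k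

end GGS

theorem mainTheorem2 (p : ℕ) (hp : p.Prime) (e : Fin (p - 1) → ZMod p) (he : e ≠ 0)
    (hconst : ∃ c : ZMod p, ∀ i, e i = c) :
    AutTree.StronglyFractal (GGS.group e) ∧
    ¬ AutTree.SuperStronglyFractal (GGS.group e) ∧
    -- the normalisation: a power of `b` is the generator with defining vector `(1, …, 1)`,
    -- and together with `a` it generates the same group
    (∃ k : ℕ, GGS.b e ^ k = GGS.b (1 : Fin (p - 1) → ZMod p)) ∧
    GGS.group e = GGS.group (1 : Fin (p - 1) → ZMod p) ∧
    -- the image of the second level stabilizer at the vertex `x₁x₁`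
    AutTree.levelImage (GGS.group e) 2 [⟨0, hp.pos⟩, ⟨0, hp.pos⟩] =
      AutTree.normalClosureIn (GGS.group e)
        {(GGS.b (1 : Fin (p - 1) → ZMod p))⁻¹ * GGS.a p} ∧
    AutTree.normalClosureIn (GGS.group e)
        {(GGS.b (1 : Fin (p - 1) → ZMod p))⁻¹ * GGS.a p} < GGS.group e := by
  have : Fact p.Prime := ⟨hp⟩
  obtain ⟨c, hc⟩ := hconst
  obtain rfl : e = fun _ => c := funext hc
  have hc0 : c ≠ 0 := by
    rintro rfl
    exact he rfl
  obtain ⟨k, hk⟩ : ∃ k : ℕ, GGS.b (fun _ : Fin (p - 1) => c) ^ k = GGS.b 1 :=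
    GGS.exists_b_const_pow_eq (d := 1) hc0
  obtain ⟨l, hl⟩ : ∃ l : ℕ, GGS.b (1 : Fin (p - 1) → ZMod p) ^ l = GGS.b fun _ => c :=
    GGS.exists_b_const_pow_eq (c := 1) one_ne_zero
  have hG : GGS.group (fun _ : Fin (p - 1) => c) = GGS.group 1 :=
    le_antisymm (GGS.group_le_of_pow hl) (GGS.group_le_of_pow hk)
  rw [hG]
  obtain ⟨n, rfl⟩ := Nat.exists_eq_add_of_le' hp.two_le
  have himage : AutTree.levelImage (GGS.constGroup n) 2 [0, 0] = GGS.diffClosure n :=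
    GGS.levelImage_two
  refine ⟨GGS.stronglyFractal_constGroup, fun h => ?_, ⟨k, hk⟩, rfl, himage, GGS.diffClosure_lt⟩
  exact GGS.diffClosure_lt.ne (himage.symm.trans (h.2 2 [0, 0] rfl))
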